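/- Let $\mathbb{K}$ be a field, $V$ a finite-dimensional $\mathbb{K}$-vector space and $S=\operatorname{Sym}(V^*)$. Let $(\mathcal{A},m)$ be a multiarrangement in $V$, that is, a finite set $\mathcal{A}$ of linear hyperplanes of $V$ together with a function $m:\mathcal{A}\to\mathbb{Z}_{>0}$. For $H\in\mathcal{A}$ let $\alpha_H\in V^*$ be a linear form with kernel $H$. The multiarrangement $(\mathcal{A},m)$ is called free if $$D(\mathcal{A},m)=\{\theta\in\operatorname{Der}_{\mathbb{K}}(S)\mid \theta(\alpha_H)\in\alpha_H^{m(H)}S\ \text{for all } H\in\mathcal{A}\}$$ is a free $S$-module. For a subspace $X\subseteq V$ put $\mathcal{A}_X=\{H\in\mathcal{A}\mid X\subseteq H\}$. A hyperplane $H_0\in\mathcal{A}$ is called locally heavy in $(\mathcal{A},m)$ if $$m(H_0)\ \ge\ \sum_{L\in\mathcal{A}_X,\ L\ne H_0} m(L)$$ for every $X\in\mathcal{A}^{H_0}=\{H_0\cap H\mid H\in\mathcal{A}\setminus\{H_0\}\}$ with $|\mathcal{A}_X|\ge 3$. Let $\delta_{H_0}:\mathcal{A}\to\mathbb{Z}$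 be the function with $\delta_{H_0}(H_0)=1$ and $\delta_{H_0}(H)=0$ for $H\neq H_0$. Call an integer $k$ (possibly negative) admissible if $m+k\delta_{H_0}$ takes only positive values (that is, $m(H_0)+k>0$) and $H_0$ is locally heavy in $(\mathcal{A},m+k\delta_{H_0})$. Suppose that $H_0\in\mathcal{A}$ is locally heavy in $(\mathcal{A},m)$. Then the following are equivalent: 1. $(\mathcal{A},m)$ is free. 2. $(\mathcal{A},m+k\delta_{H_0})$ is free for some admissible $k\in\mathbb{Z}$. 3. $(\mathcal{A},m+k\delta_{H_0})$ is free for all admissible $k\in\mathbb{Z}$. -/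

import Mathlib

/-- A central arrangement: a finite set of hyperplanes, i.e. of linear subspaces of codimension one,
in a `K`-vector space `V`. -/
structure Arrangement (K V : Type*) [Field K] [AddCommGroup V] [Module K V] where
  /-- the hyperplanes of the arrangement -/
  hyperplanes : Finset (Submodule K V)
  codim_eq_one : ∀ H ∈ hyperplanes, Module.finrank K (V ⧸ H) = 1

namespace Arrangement

noncomputable section

open scoped Classical

variable {K V : Type*} [Field K] [AddCommGroup V] [Module K V]

/-- The type of hyperplanes of `A`. -/
abbrev Hyp (A : Arrangement K V) : Type _ := {H : Submodule K V // H ∈ A.hyperplanes}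

/-- A multiplicity on `A`, i.e. a function from the hyperplanes of `A` to the positive integers.
A multiarrangement is a pair `(A, m)` where `m` is a multiplicity on `A`. -/
abbrev Multiplicity (A : Arrangement K V) : Type _ := A.Hyp → ℕ+

/-- The hyperplanes of the localization `A_X`: those hyperplanes of `A` that contain `X`. -/
def localization (A : Arrangement K V) (X : Submodule K V) : Finset A.Hyp :=
  Finset.univ.filter fun H => X ≤ H.1

/-- The restriction `A^{H₀} = {H₀ ∩ H | H ∈ A, H ≠ H₀}`, its members regarded as subspaces of `V`. -/
def restriction (A : Arrangement K V) (H₀ : A.Hyp) : Set (Submodule K V) :=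
  {X | ∃ H : A.Hyp, H ≠ H₀ ∧ X = H₀.1 ⊓ H.1}

/-- `H₀` is locally heavy in `(A, m)`: `m(H₀) ≥ ∑ m(L)`, the sum over `L ∈ A_X` with `L ≠ H₀`,
for every `X ∈ A^{H₀}` with `|A_X| ≥ 3`. -/
def IsLocallyHeavy (A : Arrangement K V) (m : A.Multiplicity) (H₀ : A.Hyp) : Prop :=
  ∀ X ∈ A.restriction H₀, 3 ≤ (A.localization X).card →
    ∑ L ∈ (A.localization X).erase H₀, (m L : ℕ) ≤ (m H₀ : ℕ)

/-- The characteristic multiplicity `δ_{H₀}`: `1` at `H₀` and `0` elsewhere. -/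
def delta (A : Arrangement K V) (H₀ : A.Hyp) : A.Hyp → ℤ :=
  fun H => if H = H₀ then 1 else 0

variable (K V) in
/-- The ring of polynomial functions `S = Sym(V^*)`. -/
abbrev PolyRing : Type _ := SymmetricAlgebra K (Module.Dual K V)

/-- The inclusion of the linear forms `V^*` into `S = Sym(V^*)`. -/
abbrev linearForm (α : Module.Dual K V) : PolyRing K V :=
  SymmetricAlgebra.ι K (Module.Dual K V) α

/-- The module `D(A, m)` of logarithmic derivations: all `K`-linear derivations `θ` of `S` such that
`θ(α) ∈ α^{m(H)} S` for every `H ∈ A` and every linear form `α` defining `H`. (The defining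
linear form of `H` is unique up to a nonzero scalar, which does not affect the condition.) -/
def logDer (A : Arrangement K V) (m : A.Multiplicity) :
    Submodule (PolyRing K V) (Derivation K (PolyRing K V) (PolyRing K V)) where
  carrier := {θ | ∀ (H : A.Hyp) (α : Module.Dual K V), LinearMap.ker α = H.1 →
    θ (linearForm α) ∈ Ideal.span {linearForm α ^ (m H : ℕ)}}
  zero_mem' := fun H α _ => by simp
  add_mem' := fun {θ η} hθ hη H α h => by
    simpa using Ideal.add_mem _ (hθ H α h) (hη H α h)
  smul_mem' := fun f θ hθ H α h => by
    simpa using Ideal.mul_mem_left _ f (hθ H α h)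

/-- `(A, m)` is free: `D(A, m)` is a free `S`-module. -/
def IsFree (A : Arrangement K V) (m : A.Multiplicity) : Prop :=
  Module.Free (PolyRing K V) (A.logDer m)

/-- `m'` is the multiplicity `m + k δ_{H₀}`, where `k` is an integer, possibly negative. For given
`A`, `m`, `H₀`, `k` there is at most one such `m'`, and there is one if and only if the function
`m + k δ_{H₀}` is positive, i.e. is a multiplicity. -/
def IsShift (A : Arrangement K V) (m : A.Multiplicity) (H₀ : A.Hyp) (k : ℤ)
    (m' : A.Multiplicity) : Prop :=
  ∀ H : A.Hyp, ((m' H : ℕ) : ℤ) = ((m H : ℕ) : ℤ) + k * A.delta H₀ H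

end

end Arrangement

/-!
Write `x = α_{H₀}`, `S = Sym(V^*)` and `n = m(H₀)`. The derivations in `D(A, m)` that kill `x` form
a submodule `D₀` that does not depend on `n`. If `D(A, m)` contains some `θ` with `θ(x) = x ^ n`,
then `D(A, m) = S θ ⊕ D₀` (`isFree_iff_free_prod_logDerKer`), so up to isomorphism `D(A, m)` does not
depend on `n` as long as such a splitting derivation exists. The theorem thus reduces to comparing
`m` with `m + δ_{H₀}`, and to finding splitting derivations for both of them when either one is free.
Multiplication by `x` passes from `m` to `m + δ_{H₀}`. The way back is division by `x`, for which the
splitting derivation has to be divisible by `x`.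

The core is therefore that a free `(A, m)` with `H₀` locally heavy has a splitting derivation which
is divisible by `x` (`IsLocallyHeavy.exists_logDer_eq_pow`). Let `Q'` be the product of the powers
`α_L ^ m(L)` over `L ≠ H₀`. The derivation `Q' x ^ n ∂_x` is logarithmic, and it must be divided by
`Q'` modulo `x D(A, m)`. Near the generic point of `H₀ ∩ L`, with `y = α_L`, there is a logarithmic
derivation `c (x ^ n ∂_x + g ∂_y)` with `c` invertible at that point and `g` a binary form of degree
`n` in `x` and `y`. The conditions on `g` are congruences for polynomials in one variable, solved by
the Chinese remainder theorem, and the inequality in local heaviness is what allows `g` to be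
divisible by `x` (`IsLocallyHeavy.exists_local_logDer`). Comparison of the two derivations shows that
`c Q' x ^ n ∂_x` lies in `Q' D(A, m) + x D(A, m)`. As `D(A, m) / x D(A, m)` is free over the domain
`S / (x)`, and `Q'` is modulo `x` a product of primes `α_L`, each coprime to its `c`, the division
by `Q'` is possible (`Module.Free.exists_eq_prod_smul_add_smul`). The quotient takes `x` to `x ^ n f`
with `f ≡ 1` modulo `x`, and its homogeneous part of degree `n` is the splitting derivation.
-/

/-! ### Symmetric algebras and their derivations -/

namespace SymmetricAlgebra

variable {K M : Type*} [Field K] [AddCommGroup M] [Module K M]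

theorem ι_injective : Function.Injective (ι K M) := by
  refine (injective_iff_map_eq_zero _).2 fun v hv =>
    (Module.forall_dual_apply_eq_zero_iff K v).1 fun ψ => ?_
  rw [← lift_ι_apply ψ v, hv, map_zero]

/-- The homomorphism `Sym M → Sym (M / ⟨u⟩)`, i.e. reduction modulo the element `u` of degree one. -/
noncomputable def modLinear (u : M) :
    SymmetricAlgebra K M →ₐ[K] SymmetricAlgebra K (M ⧸ Submodule.span K {u}) :=
  lift (ι K _ ∘ₗ (Submodule.span K {u}).mkQ)

@[simp]
theorem modLinear_ι (u v : M) :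
    modLinear u (ι K M v) = ι K _ ((Submodule.span K {u}).mkQ v) := by
  simp [modLinear]

theorem modLinear_self (u : M) : modLinear u (ι K M u) = 0 := by
  rw [modLinear_ι, (Submodule.mkQ_apply _ _).trans
    ((Submodule.Quotient.mk_eq_zero _).2 (Submodule.mem_span_singleton_self u)), map_zero]

theorem modLinear_surjective (u : M) : Function.Surjective (modLinear (K := K) u) := by
  intro s
  induction s using SymmetricAlgebra.induction with
  | algebraMap r => exact ⟨algebraMap _ _ r, by simp⟩
  | ι v =>
    obtain ⟨w, rfl⟩ := Submodule.mkQ_surjective _ v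
    exact ⟨ι K M w, modLinear_ι u w⟩
  | mul a b ha hb =>
    obtain ⟨a, rfl⟩ := ha
    obtain ⟨b, rfl⟩ := hb
    exact ⟨a * b, map_mul _ _ _⟩
  | add a b ha hb =>
    obtain ⟨a, rfl⟩ := ha
    obtain ⟨b, rfl⟩ := hb
    exact ⟨a + b, map_add _ _ _⟩

theorem modLinear_eq_zero_iff (u : M) (s : SymmetricAlgebra K M) :
    modLinear u s = 0 ↔ ι K M u ∣ s := by
  refine ⟨fun hs => ?_, ?_⟩
  · obtain ⟨t, ht⟩ := (Submodule.span K {u}).mkQ.exists_rightInverse_of_surjective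
      (Submodule.range_mkQ _)
    let ρ : SymmetricAlgebra K (M ⧸ Submodule.span K {u}) →ₐ[K] SymmetricAlgebra K M :=
      lift (ι K M ∘ₗ t)
    let q := Ideal.Quotient.mkₐ K (Ideal.span {ι K M u})
    -- Modulo `u`, the section `ρ` is inverse to the reduction; this is checked on generators.
    have key : (q.comp ρ).comp (modLinear u) = q := by
      ext v
      have hv : t ((Submodule.span K {u}).mkQ v) - v ∈ Submodule.span K {u} := by
        rw [← Submodule.Quotient.mk_eq_zero, ← Submodule.mkQ_apply, map_sub, sub_eq_zero]
        exact congr($ht _)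
      obtain ⟨a, ha⟩ := Submodule.mem_span_singleton.1 hv
      change q (ρ (modLinear u (ι K M v))) = q (ι K M v)
      rw [modLinear_ι, lift_ι_apply]
      refine (Ideal.Quotient.eq).2 ?_
      rw [LinearMap.comp_apply, ← map_sub, ← ha, map_smul, Algebra.smul_def]
      exact Ideal.mul_mem_left _ _ (Ideal.mem_span_singleton_self _)
    have h0 : q s = 0 := by
      rw [← key, AlgHom.comp_apply, hs, map_zero]
    exact Ideal.mem_span_singleton.1 (Ideal.Quotient.eq_zero_iff_mem.1 h0)
  · rintro ⟨t, rfl⟩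
    rw [map_mul, modLinear_self, zero_mul]

theorem ι_dvd_ι_iff {u v : M} : ι K M u ∣ ι K M v ↔ v ∈ Submodule.span K {u} := by
  rw [← modLinear_eq_zero_iff, modLinear_ι, map_eq_zero_iff _ ι_injective, Submodule.mkQ_apply,
    Submodule.Quotient.mk_eq_zero]

theorem prime_ι {u : M} (hu : u ≠ 0) : Prime (ι K M u) := by
  refine ⟨(map_ne_zero_iff _ ι_injective).2 hu, fun h => ?_, fun a b => ?_⟩
  · have := h.map (modLinear u)
    rw [modLinear_self] at this
    exact not_isUnit_zero this
  · simp only [← modLinear_eq_zero_iff, map_mul, mul_eq_zero, imp_self]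

/-- The derivation of `Sym M` with prescribed values on `M`. -/
noncomputable def mkDerivation (f : M →ₗ[K] SymmetricAlgebra K M) :
    Derivation K (SymmetricAlgebra K M) (SymmetricAlgebra K M) :=
  -- A derivation is the second component of a section of the trivial square-zero extension.
  let Φ : SymmetricAlgebra K M →ₐ[K]
      TrivSqZeroExt (SymmetricAlgebra K M) (SymmetricAlgebra K M) :=
    lift ((TrivSqZeroExt.inlAlgHom K _ _).toLinearMap ∘ₗ ι K M +
      (TrivSqZeroExt.inrHom (SymmetricAlgebra K M) (SymmetricAlgebra K M)).restrictScalars K ∘ₗ f)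
  have hΦ : ∀ s, (Φ s).fst = s := fun s => by
    have : (TrivSqZeroExt.fstHom K _ _).comp Φ = AlgHom.id K _ := by
      ext v
      simp [Φ]
    exact congr($this s)
  Derivation.mk'
    { toFun := fun s => (Φ s).snd
      map_add' := fun a b => by simp
      map_smul' := fun a b => by simp }
    fun a b => by
      simp [hΦ, TrivSqZeroExt.snd_mul, mul_comm]

@[simp]
theorem mkDerivation_ι (f : M →ₗ[K] SymmetricAlgebra K M) (v : M) :
    mkDerivation f (ι K M v) = f v := by
  simp [mkDerivation]

/-- The homomorphism `Sym M → (Sym M)[T]` that multiplies an element of degree `d` by `T ^ d`. -/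
noncomputable def gradingHom : SymmetricAlgebra K M →ₐ[K] Polynomial (SymmetricAlgebra K M) :=
  lift ((Polynomial.monomial 1).restrictScalars K ∘ₗ ι K M)

theorem gradingHom_ι (v : M) :
    gradingHom (ι K M v) = Polynomial.C (ι K M v) * Polynomial.X := by
  simp [gradingHom, Polynomial.C_mul_X_eq_monomial]

/-- The homogeneous component of degree `d` of an element of `Sym M`. -/
noncomputable def component (d : ℕ) : SymmetricAlgebra K M →ₗ[K] SymmetricAlgebra K M :=
  (Polynomial.lcoeff _ d).restrictScalars K ∘ₗ gradingHom.toLinearMap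

theorem component_pow_mul (d n : ℕ) (v : M) (s : SymmetricAlgebra K M) :
    component d (ι K M v ^ n * s) = if n ≤ d then ι K M v ^ n * component (d - n) s else 0 := by
  simp only [component, LinearMap.comp_apply, AlgHom.toLinearMap_apply, map_mul, map_pow,
    gradingHom_ι, mul_pow, LinearMap.coe_restrictScalars, Polynomial.lcoeff_apply]
  rw [← Polynomial.C_pow, mul_assoc, Polynomial.coeff_C_mul, Polynomial.coeff_X_pow_mul']
  split_ifs <;> simp

theorem pow_dvd_component (d n : ℕ) (v : M) {s : SymmetricAlgebra K M} (h : ι K M v ^ n ∣ s) :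
    ι K M v ^ n ∣ component d s := by
  obtain ⟨t, rfl⟩ := h
  rw [component_pow_mul]
  split_ifs
  · exact dvd_mul_right _ _
  · exact dvd_zero _

theorem component_zero_one : component 0 (1 : SymmetricAlgebra K M) = 1 := by
  simp [component]

/-- Divisibility of all values of a derivation of `Sym M` can be tested on `M`. -/
theorem dvd_derivation_apply {θ : Derivation K (SymmetricAlgebra K M) (SymmetricAlgebra K M)}
    {a : SymmetricAlgebra K M} (h : ∀ v, a ∣ θ (ι K M v)) (s : SymmetricAlgebra K M) :
    a ∣ θ s := by
  induction s using SymmetricAlgebra.induction with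
  | algebraMap r => simp
  | ι v => exact h v
  | mul s t hs ht =>
    rw [Derivation.leibniz]
    exact dvd_add (Dvd.dvd.mul_left ht _) (Dvd.dvd.mul_left hs _)
  | add s t hs ht =>
    rw [map_add]
    exact dvd_add hs ht

end SymmetricAlgebra

theorem Derivation.exists_eq_smul_of_dvd {K S : Type*} [CommRing K] [CommRing S] [IsDomain S]
    [Algebra K S] {θ : Derivation K S S} {a : S} (ha : a ≠ 0) (h : ∀ s, a ∣ θ s) :
    ∃ η : Derivation K S S, θ = a • η := by
  choose f hf using h
  refine ⟨Derivation.mk'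
    { toFun := f
      map_add' := fun s t => mul_left_cancel₀ ha ?_
      map_smul' := fun c s => mul_left_cancel₀ ha ?_ } fun s t => mul_left_cancel₀ ha ?_, ?_⟩
  · rw [← hf, map_add, mul_add, ← hf, ← hf]
  · rw [← hf, map_smul, hf, RingHom.id_apply, mul_smul_comm]
  · simp only [LinearMap.coe_mk, AddHom.coe_mk, smul_eq_mul]
    rw [← hf, θ.leibniz, hf s, hf t, smul_eq_mul, smul_eq_mul]
    ring
  · ext s
    exact hf s

/-! ### Divisibility in free modules -/

/-- If a product of prime powers divides, for each of the primes involved, a multiple `c * e` with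
`c` prime to that prime, then it divides `e`. -/
theorem Finset.prod_prime_pow_dvd_of_forall_exists {R ι : Type*} [CommRing R] [IsDomain R]
    (s : Finset ι) (p : ι → R) (n : ι → ℕ) (hp : ∀ i ∈ s, Prime (p i)) (e : R)
    (h : ∀ i ∈ s, ∃ c, ¬ p i ∣ c ∧ ∏ j ∈ s, p j ^ n j ∣ c * e) :
    ∏ j ∈ s, p j ^ n j ∣ e := by
  induction s using Finset.cons_induction with
  | empty => simp
  | cons i s hi ih =>
    simp only [Finset.prod_cons, Finset.mem_cons, forall_eq_or_imp] at hp h ⊢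
    obtain ⟨e', rfl⟩ := ih hp.2 fun j hj => by
      obtain ⟨c, hc, hd⟩ := h.2 j hj
      exact ⟨c, hc, (dvd_mul_left _ _).trans hd⟩
    have hs : ∏ j ∈ s, p j ^ n j ≠ 0 :=
      Finset.prod_ne_zero_iff.2 fun j hj => pow_ne_zero _ (hp.2 j hj).ne_zero
    obtain ⟨c, hc, hd⟩ := h.1
    rw [mul_left_comm, mul_comm (p i ^ n i)] at hd
    rw [mul_comm]
    exact mul_dvd_mul_left _
      (hp.1.pow_dvd_of_dvd_mul_left _ hc ((mul_dvd_mul_iff_left hs).1 hd))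

/-- The divisibility criterion `Finset.prod_prime_pow_dvd_of_forall_exists` in a free module,
modulo an element `x` for which `S / (x)` is a domain. This is where freeness enters. -/
theorem Module.Free.exists_eq_prod_smul_add_smul {S S' ι D : Type*} [CommRing S] [CommRing S']
    [IsDomain S'] [AddCommGroup D] [Module S D] [Module.Free S D] (π : S →+* S')
    (hπ : Function.Surjective π) {x : S} (hx : ∀ t, π t = 0 ↔ x ∣ t)
    (s : Finset ι) (p : ι → S) (n : ι → ℕ) (hp : ∀ i ∈ s, Prime (π (p i))) (e : D)
    (h : ∀ i ∈ s, ∃ (c : S) (d d' : D), ¬ π (p i) ∣ π c ∧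
      c • e = (∏ j ∈ s, p j ^ n j) • d + x • d') :
    ∃ d d' : D, e = (∏ j ∈ s, p j ^ n j) • d + x • d' := by
  let b := Module.Free.chooseBasis S D
  set Q := ∏ j ∈ s, p j ^ n j with hQ
  have hx0 : π x = 0 := (hx x).2 dvd_rfl
  have key : ∀ k, ∃ w w' : S, b.repr e k = Q * w + x * w' := fun k => by
    have hdvd : π Q ∣ π (b.repr e k) := by
      simp only [hQ, map_prod, map_pow]
      refine Finset.prod_prime_pow_dvd_of_forall_exists s (fun j => π (p j)) n hp _ fun i hi => ?_
      obtain ⟨c, d, d', hc, hd⟩ := h i hi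
      refine ⟨π c, hc, π (b.repr d k), ?_⟩
      have := congr(π (b.repr $hd k))
      simpa [hx0, hQ] using this
    obtain ⟨w, hw⟩ := hdvd
    obtain ⟨w, rfl⟩ := hπ w
    obtain ⟨w', hw'⟩ := (hx (b.repr e k - Q * w)).1 (by rw [map_sub, map_mul, hw, sub_self])
    exact ⟨w, w', by rw [← hw']; ring⟩
  have hmem : e ∈ LinearMap.range (LinearMap.lsmul S D Q) ⊔
      LinearMap.range (LinearMap.lsmul S D x) := by
    rw [← b.linearCombination_repr e, Finsupp.linearCombination_apply]
    refine Submodule.sum_mem _ fun k _ => ?_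
    obtain ⟨w, w', hw⟩ := key k
    change b.repr e k • b k ∈ _
    rw [hw, add_smul, mul_smul, mul_smul]
    exact Submodule.add_mem_sup ⟨_, rfl⟩ ⟨_, rfl⟩
  obtain ⟨_, ⟨d, rfl⟩, _, ⟨d', rfl⟩, hd⟩ := Submodule.mem_sup.1 hmem
  exact ⟨d, d', hd.symm⟩

/-! ### Congruences for binary forms -/

namespace Polynomial

variable {K ι : Type*} [Field K]

theorem exists_degree_lt_forall_pow_dvd_sub_C (s : Finset ι) (r : ι → K)
    (hr : Set.InjOn r s) (n : ι → ℕ) :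
    ∃ G : K[X], G.degree < ((∑ i ∈ s, n i : ℕ) : WithBot ℕ) ∧
      ∀ i ∈ s, (X - C (r i)) ^ n i ∣ G - C (r i) := by
  have hcop : Pairwise fun i j : s =>
      IsCoprime (Ideal.span {(X - C (r i)) ^ n i}) (Ideal.span {(X - C (r j)) ^ n j}) := by
    intro i j hij
    rw [Ideal.isCoprime_span_singleton_iff]
    exact (isCoprime_X_sub_C_of_isUnit_sub
      (sub_ne_zero.2 fun h => hij (Subtype.ext (hr i.2 j.2 h))).isUnit).pow
  obtain ⟨F, hF⟩ := Ideal.exists_forall_sub_mem_ideal hcop (fun i => C (r i))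
  have hP : (∏ i ∈ s, (X - C (r i)) ^ n i).Monic :=
    monic_prod_of_monic _ _ fun i _ => (monic_X_sub_C _).pow _
  refine ⟨F %ₘ ∏ i ∈ s, (X - C (r i)) ^ n i, (degree_modByMonic_lt _ hP).trans_eq ?_,
    fun i hi => ?_⟩
  · rw [degree_prod]
    simp
  · have h1 := Ideal.mem_span_singleton.1 (hF ⟨i, hi⟩)
    have h2 : (X - C (r i)) ^ n i ∣ F - F %ₘ ∏ i ∈ s, (X - C (r i)) ^ n i := by
      refine (Finset.dvd_prod_of_mem (fun i => (X - C (r i)) ^ n i) hi).trans ?_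
      refine ⟨F /ₘ ∏ i ∈ s, (X - C (r i)) ^ n i, ?_⟩
      rw [sub_eq_iff_eq_add', modByMonic_add_div]
    have h3 := dvd_sub h1 h2
    simpa using h3

/-- A simultaneous congruence in binary forms of degree `N` in `y` and `x`. As `N` is at least the
total multiplicity, the solution can be taken divisible by `x`. -/
theorem exists_binary_form {S : Type*} [CommRing S] [Algebra K S] (x y : S) (s : Finset ι)
    (r : ι → K) (hr : Set.InjOn r s) (n : ι → ℕ) {N : ℕ} (hN : 0 < N) (hn : ∑ i ∈ s, n i ≤ N) :
    ∃ g : S, x ∣ g ∧ ∀ i ∈ s, (y - r i • x) ^ n i ∣ g - r i • x ^ N := by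
  obtain ⟨G, hdeg, hG⟩ := exists_degree_lt_forall_pow_dvd_sub_C s r hr n
  have hGN : G.natDegree ≤ N - 1 := by
    rcases eq_or_ne G 0 with rfl | h0
    · simp
    · have := (natDegree_lt_iff_degree_lt h0).2 hdeg
      omega
  refine ⟨MvPolynomial.aeval ![y, x] (G.homogenize N), ?_, fun i hi => ?_⟩
  · have h := homogenize_mul G 1 hGN (n := 1) (by simp)
    rw [mul_one, Nat.sub_add_cancel hN, homogenize_one] at h
    rw [h, map_mul]
    exact Dvd.dvd.mul_left (by simp) _
  · obtain ⟨W, hW⟩ := hG i hi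
    have hi' : n i ≤ N := (Finset.single_le_sum (fun j _ => Nat.zero_le (n j)) hi).trans hn
    have hWN : W.natDegree ≤ N - n i := by
      rcases eq_or_ne W 0 with rfl | h0
      · simp
      · have h1 : ((X - C (r i)) ^ n i * W).natDegree = n i + W.natDegree := by
          rw [((monic_X_sub_C _).pow _).natDegree_mul' h0]
          simp
        have h2 : (G - C (r i)).natDegree ≤ N := by
          rw [natDegree_sub_C]
          omega
        rw [hW, h1] at h2
        omega
    have h1 := homogenize_finsetProd (s := Finset.range (n i)) (p := fun _ => X - C (r i))
      (n := fun _ => 1) (fun _ _ => (natDegree_X_sub_C _).le)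
    simp only [Finset.prod_const, Finset.card_range, Finset.sum_const, smul_eq_mul, mul_one] at h1
    have h2 := homogenize_mul ((X - C (r i)) ^ n i) W (m := n i) (by simp) hWN
    rw [← hW, Nat.add_sub_cancel' hi', h1] at h2
    have h3 := congr(MvPolynomial.aeval ![y, x] $h2)
    simp only [homogenize_sub, homogenize_C, map_sub, map_mul, map_pow, MvPolynomial.aeval_X,
      homogenize_X one_ne_zero] at h3
    refine ⟨MvPolynomial.aeval ![y, x] (W.homogenize (N - n i)), ?_⟩
    simpa [Algebra.smul_def, MvPolynomial.algebraMap_eq] using h3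

end Polynomial

/-! ### Defining forms and logarithmic derivations -/

namespace Arrangement

noncomputable section

open scoped Classical

open SymmetricAlgebra

variable {K V : Type*} [Field K] [AddCommGroup V] [Module K V]

theorem _root_.Module.Dual.mem_span_singleton_of_ker_le {f g : Module.Dual K V}
    (h : LinearMap.ker f ≤ LinearMap.ker g) : g ∈ Submodule.span K {f} := by
  have := mem_span_of_iInf_ker_le_ker (L := fun _ : Unit => f) (K := g) (by simpa using h)
  simpa using this

theorem _root_.Module.exists_dual_eq_one_and_eq_zero {M : Type*} [AddCommGroup M] [Module K M]
    {x y : M} (h : x ∉ Submodule.span K {y}) : ∃ f : Module.Dual K M, f x = 1 ∧ f y = 0 := by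
  obtain ⟨f, hf, hle⟩ := Submodule.exists_le_ker_of_notMem h
  exact ⟨(f x)⁻¹ • f, by simp [hf],
    by simp [LinearMap.mem_ker.1 (hle (Submodule.mem_span_singleton_self y))]⟩

variable (A : Arrangement K V)

theorem exists_ker_eq (H : A.Hyp) : ∃ α : Module.Dual K V, LinearMap.ker α = H.1 := by
  obtain ⟨e⟩ := Module.nonempty_linearEquiv_of_finrank_eq_one (A.codim_eq_one H.1 H.2)
  exact ⟨e.symm.toLinearMap ∘ₗ H.1.mkQ, by rw [LinearEquiv.ker_comp, Submodule.ker_mkQ]⟩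

/-- A chosen linear form `α_H` defining the hyperplane `H`. -/
def form (H : A.Hyp) : Module.Dual K V := (A.exists_ker_eq H).choose

theorem ker_form (H : A.Hyp) : LinearMap.ker (A.form H) = H.1 := (A.exists_ker_eq H).choose_spec

theorem form_ne_zero (H : A.Hyp) : A.form H ≠ 0 := by
  intro h
  have h1 := A.ker_form H
  have h2 := A.codim_eq_one H.1 H.2
  rw [h, LinearMap.ker_zero] at h1
  rw [← h1, Module.finrank_zero_of_subsingleton] at h2
  exact zero_ne_one h2

theorem form_mem_span_form_iff {H L : A.Hyp} :
    A.form H ∈ Submodule.span K {A.form L} ↔ H = L := by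
  refine ⟨fun h => ?_, fun h => h ▸ Submodule.mem_span_singleton_self _⟩
  obtain ⟨a, ha⟩ := Submodule.mem_span_singleton.1 h
  have ha0 : a ≠ 0 := by
    rintro rfl
    exact A.form_ne_zero H (by rw [← ha, zero_smul])
  rw [Subtype.ext_iff, ← ker_form, ← ker_form, ← ha, LinearMap.ker_smul _ _ ha0]

theorem prime_linearForm (H : A.Hyp) : Prime (linearForm (A.form H)) := prime_ι (A.form_ne_zero H)

variable {A}

theorem linearForm_dvd_linearForm_iff {H L : A.Hyp} :
    linearForm (A.form L) ∣ linearForm (A.form H) ↔ H = L :=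
  ι_dvd_ι_iff.trans A.form_mem_span_form_iff

theorem linearForm_smul (a : K) (α : Module.Dual K V) :
    linearForm (a • α) = a • linearForm α :=
  (ι K (Module.Dual K V)).map_smul a α

variable {m : A.Multiplicity} {H₀ : A.Hyp}

theorem mem_logDer_iff {θ : Derivation K (PolyRing K V) (PolyRing K V)} :
    θ ∈ A.logDer m ↔
      ∀ H, linearForm (A.form H) ^ (m H : ℕ) ∣ θ (linearForm (A.form H)) := by
  refine ⟨fun h H => Ideal.mem_span_singleton.1 (h H _ (A.ker_form H)), fun h H α hα => ?_⟩
  rw [Ideal.mem_span_singleton]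
  obtain ⟨a, ha⟩ := Submodule.mem_span_singleton.1
    (Module.Dual.mem_span_singleton_of_ker_le (hα.trans (A.ker_form H).symm).le)
  obtain ⟨b, hb⟩ := Submodule.mem_span_singleton.1
    (Module.Dual.mem_span_singleton_of_ker_le (hα.trans (A.ker_form H).symm).ge)
  have h1 : linearForm α ^ (m H : ℕ) ∣ linearForm (A.form H) ^ (m H : ℕ) := by
    rw [← ha, linearForm_smul, smul_pow]
    exact dvd_smul_of_dvd _ dvd_rfl
  have h2 : θ (linearForm (A.form H)) ∣ θ (linearForm α) := by
    rw [← hb, linearForm_smul, θ.map_smul]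
    exact dvd_smul_of_dvd _ dvd_rfl
  exact (h1.trans (h H)).trans h2

/-- A derivation that kills `α_{H₀}` is logarithmic as soon as its multiple by `α_{H₀}` is. -/
theorem mem_logDer_of_smul_mem {θ : Derivation K (PolyRing K V) (PolyRing K V)}
    (h0 : θ (linearForm (A.form H₀)) = 0) (h : linearForm (A.form H₀) • θ ∈ A.logDer m) :
    θ ∈ A.logDer m := by
  refine mem_logDer_iff.2 fun H => ?_
  rcases eq_or_ne H H₀ with rfl | hH
  · rw [h0]
    exact dvd_zero _
  · exact (A.prime_linearForm H).pow_dvd_of_dvd_mul_left _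
      (fun hd => hH (linearForm_dvd_linearForm_iff.1 hd).symm) (mem_logDer_iff.1 h H)

variable (m H₀) in
/-- The product `∏ α_L ^ m(L)` over the hyperplanes `L ≠ H₀`. -/
def deletedPoly : PolyRing K V :=
  ∏ L ∈ Finset.univ.erase H₀, linearForm (A.form L) ^ (m L : ℕ)

theorem not_dvd_deletedPoly : ¬ linearForm (A.form H₀) ∣ deletedPoly m H₀ := by
  intro h
  obtain ⟨L, hL, hd⟩ := (A.prime_linearForm H₀).exists_mem_finset_dvd h
  exact (Finset.mem_erase.1 hL).1
    (linearForm_dvd_linearForm_iff.1 ((A.prime_linearForm H₀).dvd_of_dvd_pow hd))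

variable (m H₀) in
/-- The derivation `Q' α ^ m(H₀) ∂_α`, where `α = α_{H₀}` and `Q'` is the product of the other forms
with their multiplicities. -/
theorem exists_mem_logDer_deletedPoly :
    ∃ θ ∈ A.logDer m,
      θ (linearForm (A.form H₀)) = deletedPoly m H₀ * linearForm (A.form H₀) ^ (m H₀ : ℕ) ∧
      ∀ v, linearForm (A.form H₀) ∣ θ (linearForm v) := by
  obtain ⟨ξ, hξ, -⟩ := Module.exists_dual_eq_one_and_eq_zero (K := K) (x := A.form H₀) (y := 0)
    (by simpa using A.form_ne_zero H₀)
  refine ⟨mkDerivation (ξ.smulRight (deletedPoly m H₀ * linearForm (A.form H₀) ^ (m H₀ : ℕ))),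
    mem_logDer_iff.2 fun H => ?_, ?_, fun v => ?_⟩
  · rw [linearForm, mkDerivation_ι, LinearMap.smulRight_apply]
    refine dvd_smul_of_dvd _ ?_
    rcases eq_or_ne H H₀ with rfl | hH
    · exact dvd_mul_left _ _
    · exact Dvd.dvd.mul_right (Finset.dvd_prod_of_mem
        (fun L => linearForm (A.form L) ^ (m L : ℕ))
        (Finset.mem_erase.2 ⟨hH, Finset.mem_univ _⟩)) _
  · rw [linearForm, mkDerivation_ι, LinearMap.smulRight_apply, hξ, one_smul]
  · rw [linearForm, mkDerivation_ι, LinearMap.smulRight_apply]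
    exact dvd_smul_of_dvd _ (Dvd.dvd.mul_left (dvd_pow_self _ (m H₀).ne_zero) _)

/-! ### Derivations near a subspace of codimension two -/

/-- In coordinates `x = α_{H₀}` and `y = α_L`, the defining form of another hyperplane through
`H₀ ∩ L` is a multiple of `y - r x` for some scalar `r`. -/
theorem exists_form_eq_smul {L H : A.Hyp} (hH : H ∈ (A.localization (H₀.1 ⊓ L.1)).erase H₀) :
    ∃ b r : K, b ≠ 0 ∧ A.form H = b • (A.form L - r • A.form H₀) := by
  obtain ⟨hne, hX⟩ := Finset.mem_erase.1 hH
  have hX' : H₀.1 ⊓ L.1 ≤ H.1 := (Finset.mem_filter.1 hX).2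
  have hspan : A.form H ∈ Submodule.span K (Set.range ![A.form H₀, A.form L]) := by
    refine mem_span_of_iInf_ker_le_ker ?_
    rw [A.ker_form H]
    refine le_trans (le_inf ?_ ?_) hX'
    · exact (iInf_le _ 0).trans (A.ker_form H₀).le
    · exact (iInf_le _ 1).trans (A.ker_form L).le
  obtain ⟨b, a, hab⟩ := Submodule.mem_span_pair.1 (by simpa using hspan)
  have hb : b ≠ 0 := by
    rintro rfl
    exact hne (A.form_mem_span_form_iff.1
      (Submodule.mem_span_singleton.2 ⟨a, by rw [← hab, zero_smul, zero_add]⟩))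
  refine ⟨b, -(b⁻¹ * a), hb, ?_⟩
  rw [← hab, smul_sub, smul_smul, mul_neg, mul_inv_cancel_left₀ hb, neg_smul, sub_neg_eq_add]

/-- The binary form `g` for which `x ^ m(H₀) ∂_x + g ∂_y` is logarithmic for all hyperplanes
through `H₀ ∩ L`; here `x = α_{H₀}` and `y = α_L`. Local heaviness allows `g` to be chosen divisible
by `x`. -/
theorem IsLocallyHeavy.exists_binary_form (hH₀ : A.IsLocallyHeavy m H₀) {L : A.Hyp} (hL : L ≠ H₀)
    (b r : A.Hyp → K) (hbr : ∀ H ∈ (A.localization (H₀.1 ⊓ L.1)).erase H₀,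
      b H ≠ 0 ∧ A.form H = b H • (A.form L - r H • A.form H₀)) :
    ∃ g : PolyRing K V, linearForm (A.form H₀) ∣ g ∧
      ∀ H ∈ (A.localization (H₀.1 ⊓ L.1)).erase H₀,
        (linearForm (A.form L) - r H • linearForm (A.form H₀)) ^ (m H : ℕ) ∣
          g - r H • linearForm (A.form H₀) ^ (m H₀ : ℕ) := by
  have hH₀mem : H₀ ∈ A.localization (H₀.1 ⊓ L.1) :=
    Finset.mem_filter.2 ⟨Finset.mem_univ _, inf_le_left⟩
  have hLmem : L ∈ (A.localization (H₀.1 ⊓ L.1)).erase H₀ :=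
    Finset.mem_erase.2 ⟨hL, Finset.mem_filter.2 ⟨Finset.mem_univ _, inf_le_right⟩⟩
  by_cases hcard : 3 ≤ (A.localization (H₀.1 ⊓ L.1)).card
  · refine Polynomial.exists_binary_form _ _ _ r (fun H hH H' hH' h => ?_) (fun H => (m H : ℕ))
      (m H₀).pos (hH₀ _ ⟨L, hL, rfl⟩ hcard)
    obtain ⟨-, h1⟩ := hbr H hH
    obtain ⟨hb, h2⟩ := hbr H' hH'
    refine A.form_mem_span_form_iff.1 (Submodule.mem_span_singleton.2 ⟨b H * (b H')⁻¹, ?_⟩)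
    rw [h1, h2, h, smul_smul, mul_assoc, inv_mul_cancel₀ hb, mul_one]
  -- Only `H₀` and `L` contain `H₀ ∩ L`, so no condition links `g` to `x`.
  · refine ⟨0, dvd_zero _, fun H hH => ?_⟩
    have hle : ((A.localization (H₀.1 ⊓ L.1)).erase H₀).card ≤ 1 := by
      rw [Finset.card_erase_of_mem hH₀mem]
      omega
    obtain rfl := Finset.card_le_one.1 hle H hH L hLmem
    obtain ⟨hb, h⟩ := hbr H hH
    have hr : r H = 0 := by
      by_contra hr
      refine hL.symm (A.form_mem_span_form_iff.1
        (Submodule.mem_span_singleton.2 ⟨(b H * r H)⁻¹ * (b H - 1), ?_⟩))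
      have h' : (b H - 1) • A.form H = (b H * r H) • A.form H₀ := by
        ext v
        have hv : A.form H v = b H * (A.form H v - r H * A.form H₀ v) := congr($h v)
        change (b H - 1) * A.form H v = b H * r H * A.form H₀ v
        linear_combination -hv
      rw [mul_smul, h', inv_smul_smul₀ (mul_ne_zero hb hr)]
    simp [hr]

/-- Near the generic point of `H₀ ∩ L` there is a logarithmic derivation that is divisible by
`α_{H₀}` and takes `α_{H₀}` to `α_{H₀} ^ m(H₀)`: the factor `c` is invertible there. -/
theorem IsLocallyHeavy.exists_local_logDer (hH₀ : A.IsLocallyHeavy m H₀) {L : A.Hyp}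
    (hL : L ≠ H₀) :
    ∃ θ ∈ A.logDer m, ∃ c : PolyRing K V,
      θ (linearForm (A.form H₀)) = c * linearForm (A.form H₀) ^ (m H₀ : ℕ) ∧
      (∀ v, linearForm (A.form H₀) ∣ θ (linearForm v)) ∧
      ¬ modLinear (A.form H₀) (linearForm (A.form L)) ∣ modLinear (A.form H₀) c := by
  have hbr : ∀ H : A.Hyp, ∃ b r : K, H ∈ (A.localization (H₀.1 ⊓ L.1)).erase H₀ →
      b ≠ 0 ∧ A.form H = b • (A.form L - r • A.form H₀) := fun H => by
    by_cases hH : H ∈ (A.localization (H₀.1 ⊓ L.1)).erase H₀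
    · obtain ⟨b, r, h⟩ := exists_form_eq_smul hH
      exact ⟨b, r, fun _ => h⟩
    · exact ⟨0, 0, fun h => absurd h hH⟩
  choose b r hbr using hbr
  obtain ⟨g, hxg, hg⟩ := hH₀.exists_binary_form hL b r hbr
  obtain ⟨ξ, hξx, hξy⟩ := Module.exists_dual_eq_one_and_eq_zero
    (mt A.form_mem_span_form_iff.1 hL.symm)
  obtain ⟨υ, hυy, hυx⟩ := Module.exists_dual_eq_one_and_eq_zero
    (mt A.form_mem_span_form_iff.1 hL)
  let c : PolyRing K V :=
    ∏ H ∈ (A.localization (H₀.1 ⊓ L.1))ᶜ, linearForm (A.form H) ^ (m H : ℕ)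
  let θ : Derivation K (PolyRing K V) (PolyRing K V) := c • mkDerivation
    (ξ.smulRight (linearForm (A.form H₀) ^ (m H₀ : ℕ)) + υ.smulRight g)
  have hθ : ∀ v, θ (linearForm v) =
      c * (ξ v • linearForm (A.form H₀) ^ (m H₀ : ℕ) + υ v • g) := fun v => by
    simp [θ]
  have hθx : θ (linearForm (A.form H₀)) = c * linearForm (A.form H₀) ^ (m H₀ : ℕ) := by
    rw [hθ, hξx, hυx, one_smul, zero_smul, add_zero]
  refine ⟨θ, mem_logDer_iff.2 fun H => ?_, c, hθx, fun v => ?_, ?_⟩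
  · by_cases hHX : H ∈ A.localization (H₀.1 ⊓ L.1)
    · rcases eq_or_ne H H₀ with rfl | hne
      · rw [hθx]
        exact dvd_mul_left _ _
      · have hH := Finset.mem_erase.2 ⟨hne, hHX⟩
        obtain ⟨-, h⟩ := hbr H hH
        have h1 : linearForm (A.form H) =
            b H • (linearForm (A.form L) - r H • linearForm (A.form H₀)) := by
          rw [h]
          simp only [linearForm, map_smul, map_sub]
        have h2 : θ (linearForm (A.form H)) =
            (c * algebraMap K _ (b H)) *
              (g - r H • linearForm (A.form H₀) ^ (m H₀ : ℕ)) := by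
          rw [hθ, h]
          simp only [map_smul, map_sub, hξx, hξy, hυx, hυy, smul_eq_mul, Algebra.smul_def, map_mul,
            map_one, map_zero]
          ring
        obtain ⟨t, ht⟩ := hg H hH
        have hb := (hbr H hH).1
        refine ⟨((b H)⁻¹ ^ (m H : ℕ)) • (c * algebraMap K _ (b H) * t), ?_⟩
        rw [h2, ht, h1, smul_pow, smul_mul_smul_comm, ← mul_pow, mul_inv_cancel₀ hb, one_pow,
          one_smul]
        ring
    · rw [hθ]
      exact Dvd.dvd.mul_right (Finset.dvd_prod_of_mem
        (fun H => linearForm (A.form H) ^ (m H : ℕ)) (Finset.mem_compl.2 hHX)) _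
  · rw [hθ]
    exact Dvd.dvd.mul_left (dvd_add (dvd_smul_of_dvd _ (dvd_pow_self _ (m H₀).ne_zero))
      (dvd_smul_of_dvd _ hxg)) _
  · intro hd
    have hp : Prime (modLinear (A.form H₀) (linearForm (A.form L))) := by
      rw [linearForm, modLinear_ι]
      refine prime_ι fun h => hL (A.form_mem_span_form_iff.1 ?_)
      exact (Submodule.Quotient.mk_eq_zero _).1 h
    rw [map_prod] at hd
    obtain ⟨H, hH, hd⟩ := hp.exists_mem_finset_dvd hd
    rw [map_pow] at hd
    replace hd := hp.dvd_of_dvd_pow hd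
    rw [linearForm, linearForm, modLinear_ι, modLinear_ι, ι_dvd_ι_iff] at hd
    obtain ⟨a, ha⟩ := Submodule.mem_span_singleton.1 hd
    rw [← map_smul, ← sub_eq_zero, ← map_sub] at ha
    obtain ⟨a', ha'⟩ := Submodule.mem_span_singleton.1 ((Submodule.Quotient.mk_eq_zero _).1 ha)
    refine Finset.mem_compl.1 hH (Finset.mem_filter.2 ⟨Finset.mem_univ _, fun v hv => ?_⟩)
    have hx : A.form H₀ v = 0 := LinearMap.mem_ker.1 ((A.ker_form H₀).symm ▸ hv.1)
    have hy : A.form L v = 0 := LinearMap.mem_ker.1 ((A.ker_form L).symm ▸ hv.2)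
    rw [← A.ker_form H, LinearMap.mem_ker]
    have := congr($ha' v)
    simpa [hx, hy] using this

/-! ### The splitting derivation -/

/-- Freeness globalizes the local derivations of `IsLocallyHeavy.exists_local_logDer`, up to a
factor that is congruent to `1` modulo `α_{H₀}`. -/
theorem IsLocallyHeavy.exists_logDer_modLinear_eq_one (hH₀ : A.IsLocallyHeavy m H₀)
    (hfree : A.IsFree m) :
    ∃ θ ∈ A.logDer m, ∃ f : PolyRing K V,
      θ (linearForm (A.form H₀)) = linearForm (A.form H₀) ^ (m H₀ : ℕ) * f ∧
      (∀ v, linearForm (A.form H₀) ∣ θ (linearForm v)) ∧ modLinear (A.form H₀) f = 1 := by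
  set x := linearForm (A.form H₀) with hx
  have hx0 : x ≠ 0 := (A.prime_linearForm H₀).ne_zero
  obtain ⟨e, he, hex, hev⟩ := exists_mem_logDer_deletedPoly m H₀
  rw [← hx] at hex hev
  have : Module.Free (PolyRing K V) (A.logDer m) := hfree
  obtain ⟨⟨d, hd⟩, ⟨d', hd'⟩, h⟩ := Module.Free.exists_eq_prod_smul_add_smul
    (modLinear (A.form H₀)).toRingHom (modLinear_surjective (A.form H₀))
    (modLinear_eq_zero_iff (A.form H₀))
    (Finset.univ.erase H₀) (fun L => linearForm (A.form L)) (fun L => (m L : ℕ))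
    (fun L hL => by
      change Prime (modLinear (A.form H₀) (ι K _ (A.form L)))
      rw [modLinear_ι]
      exact prime_ι fun h => (Finset.mem_erase.1 hL).1
        (A.form_mem_span_form_iff.1 ((Submodule.Quotient.mk_eq_zero _).1 h)))
    (⟨e, he⟩ : A.logDer m) fun L hL => by
      obtain ⟨θ, hθ, c, hθx, hθv, hc⟩ := hH₀.exists_local_logDer (Finset.mem_erase.1 hL).1
      -- The difference `c e - Q' θ` kills `x` and is divisible by `x`; the quotient is logarithmic.
      obtain ⟨η, hη⟩ := Derivation.exists_eq_smul_of_dvd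
        (θ := c • e - deletedPoly m H₀ • θ) hx0 (dvd_derivation_apply fun v => by
          simp only [Derivation.sub_apply, Derivation.smul_apply, smul_eq_mul]
          exact dvd_sub (Dvd.dvd.mul_left (hev v) _) (Dvd.dvd.mul_left (hθv v) _))
      have hmem : x • η ∈ A.logDer m := by
        rw [← hη]
        exact sub_mem (Submodule.smul_mem _ _ he) (Submodule.smul_mem _ _ hθ)
      have hηx : η x = 0 := by
        have h1 := congr($hη x)
        simp only [Derivation.sub_apply, Derivation.smul_apply, smul_eq_mul, hex] at h1
        rw [hx, hθx, ← hx, mul_left_comm, sub_self] at h1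
        exact (mul_eq_zero.1 h1.symm).resolve_left hx0
      refine ⟨c, ⟨θ, hθ⟩, ⟨η, mem_logDer_of_smul_mem hηx hmem⟩, hc, Subtype.ext ?_⟩
      exact sub_eq_iff_eq_add'.1 hη
  change _ = deletedPoly m H₀ • _ + x • _ at h
  have h : e = deletedPoly m H₀ • d + x • d' := congr(($h).1)
  obtain ⟨f, hf⟩ := mem_logDer_iff.1 hd H₀
  obtain ⟨f', hf'⟩ := mem_logDer_iff.1 hd' H₀
  rw [← hx] at hf hf'
  have hQ : deletedPoly m H₀ = deletedPoly m H₀ * f + x * f' := by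
    have h1 := congr($h x)
    simp only [Derivation.add_apply, Derivation.smul_apply, smul_eq_mul, hex, hf, hf'] at h1
    refine mul_right_cancel₀ (pow_ne_zero (m H₀ : ℕ) hx0) (h1.trans ?_)
    ring
  refine ⟨d, hd, f, hf, fun v => ?_, ?_⟩
  · have h1 : deletedPoly m H₀ * d (linearForm v) = e (linearForm v) - x * d' (linearForm v) := by
      rw [h]
      simp
    exact ((A.prime_linearForm H₀).dvd_or_dvd
      (h1 ▸ dvd_sub (hev v) (dvd_mul_right _ _))).resolve_left not_dvd_deletedPoly
  · have h1 : linearForm (A.form H₀) ∣ deletedPoly m H₀ * (f - 1) := ⟨-f', by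
      rw [← hx]
      linear_combination -hQ⟩
    have h2 := ((A.prime_linearForm H₀).dvd_or_dvd h1).resolve_left not_dvd_deletedPoly
    rw [linearForm, ← modLinear_eq_zero_iff, map_sub, map_one, sub_eq_zero] at h2
    exact h2

/-- The unit factor in `IsLocallyHeavy.exists_logDer_modLinear_eq_one` is removed by passing to
homogeneous components of degree `m(H₀)`. -/
theorem IsLocallyHeavy.exists_logDer_eq_pow (hH₀ : A.IsLocallyHeavy m H₀) (hfree : A.IsFree m) :
    ∃ θ ∈ A.logDer m,
      θ (linearForm (A.form H₀)) = linearForm (A.form H₀) ^ (m H₀ : ℕ) ∧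
      ∀ v, linearForm (A.form H₀) ∣ θ (linearForm v) := by
  obtain ⟨θ, hθ, f, hθx, hθv, hf⟩ := hH₀.exists_logDer_modLinear_eq_one hfree
  let θ' := mkDerivation (component (m H₀ : ℕ) ∘ₗ θ.toLinearMap ∘ₗ ι K (Module.Dual K V))
  have hθ' : ∀ v, θ' (linearForm v) = component (m H₀ : ℕ) (θ (linearForm v)) := fun v => by
    simp [θ', linearForm]
  refine ⟨θ', mem_logDer_iff.2 fun H => ?_, ?_, fun v => ?_⟩
  · rw [hθ']
    exact pow_dvd_component _ _ _ (mem_logDer_iff.1 hθ H)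
  · rw [← map_one (modLinear (A.form H₀)), ← sub_eq_zero, ← map_sub, modLinear_eq_zero_iff] at hf
    obtain ⟨t, ht⟩ := hf
    have h1 : f = 1 + ι K _ (A.form H₀) ^ 1 * t := by
      rw [pow_one, ← ht, add_sub_cancel]
    rw [hθ', hθx, component_pow_mul, if_pos le_rfl, Nat.sub_self, h1, map_add, component_zero_one,
      component_pow_mul, if_neg (by simp), add_zero, mul_one]
  · rw [hθ']
    have := pow_dvd_component (m H₀ : ℕ) 1 (A.form H₀) (by simpa using hθv v)
    simpa using this

/-! ### Shifting the multiplicity of a locally heavy hyperplane -/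

variable (m H₀) in
/-- The logarithmic derivations that kill `α_{H₀}`. -/
def logDerKer : Submodule (PolyRing K V) (Derivation K (PolyRing K V) (PolyRing K V)) where
  carrier := {θ | θ ∈ A.logDer m ∧ θ (linearForm (A.form H₀)) = 0}
  zero_mem' := ⟨zero_mem _, rfl⟩
  add_mem' := fun hθ hη => ⟨add_mem hθ.1 hη.1, by rw [Derivation.add_apply, hθ.2, hη.2, add_zero]⟩
  smul_mem' := fun f _ hθ =>
    ⟨Submodule.smul_mem _ f hθ.1, by rw [Derivation.smul_apply, hθ.2, smul_zero]⟩

theorem logDerKer_congr {m' : A.Multiplicity} (h : ∀ H ≠ H₀, m' H = m H) :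
    logDerKer m' H₀ = logDerKer m H₀ := by
  ext θ
  refine and_congr_left fun h0 => ?_
  rw [mem_logDer_iff, mem_logDer_iff]
  refine forall_congr' fun H => ?_
  rcases eq_or_ne H H₀ with rfl | hH
  · simp [h0]
  · rw [h H hH]

/-- A logarithmic derivation `θ` with `θ(α_{H₀}) = α_{H₀} ^ m(H₀)` splits off `D(A, m)` as a free
summand, with the derivations that kill `α_{H₀}` as a complement. -/
theorem isFree_iff_free_prod_logDerKer {θ : Derivation K (PolyRing K V) (PolyRing K V)}
    (hθ : θ ∈ A.logDer m)
    (hθx : θ (linearForm (A.form H₀)) = linearForm (A.form H₀) ^ (m H₀ : ℕ)) :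
    A.IsFree m ↔ Module.Free (PolyRing K V) (PolyRing K V × logDerKer m H₀) := by
  have hx0 : linearForm (A.form H₀) ≠ 0 := (A.prime_linearForm H₀).ne_zero
  let Φ : (PolyRing K V × logDerKer m H₀) →ₗ[PolyRing K V] A.logDer m :=
    (LinearMap.toSpanSingleton _ _ (⟨θ, hθ⟩ : A.logDer m)).coprod
      (Submodule.inclusion fun η hη => hη.1)
  have hΦ : ∀ p, (Φ p).1 = p.1 • θ + p.2.1 := fun p => rfl
  have hinj : Function.Injective Φ := by
    refine (injective_iff_map_eq_zero _).2 fun p hp => ?_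
    have h1 : p.1 • θ + p.2.1 = 0 := (hΦ p).symm.trans congr(($hp).1)
    have h2 := congr($h1 (linearForm (A.form H₀)))
    rw [Derivation.add_apply, Derivation.smul_apply, hθx, p.2.2.2, add_zero, smul_eq_mul,
      Derivation.zero_apply] at h2
    have h3 : p.1 = 0 := (mul_eq_zero.1 h2).resolve_right (pow_ne_zero _ hx0)
    rw [h3, zero_smul, zero_add] at h1
    exact Prod.ext h3 (Subtype.ext h1)
  have hsurj : Function.Surjective Φ := by
    rintro ⟨η, hη⟩
    obtain ⟨s, hs⟩ := mem_logDer_iff.1 hη H₀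
    refine ⟨⟨s, ⟨η - s • θ, sub_mem hη (Submodule.smul_mem _ _ hθ), ?_⟩⟩, Subtype.ext ?_⟩
    · rw [Derivation.sub_apply, Derivation.smul_apply, hθx, hs, smul_eq_mul, mul_comm, sub_self]
    · rw [hΦ]
      exact add_sub_cancel _ _
  exact ⟨fun h => Module.Free.of_equiv' h (LinearEquiv.ofBijective Φ ⟨hinj, hsurj⟩).symm,
    fun h => Module.Free.of_equiv' h (LinearEquiv.ofBijective Φ ⟨hinj, hsurj⟩)⟩

/-- Freeness is unchanged when the multiplicity of a locally heavy hyperplane is raised by one. -/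
theorem IsLocallyHeavy.isFree_iff_of_eq_add_one {m' : A.Multiplicity}
    (hH₀ : A.IsLocallyHeavy m H₀) (hH₀' : A.IsLocallyHeavy m' H₀) (h : ∀ H ≠ H₀, m' H = m H)
    (h₀ : (m' H₀ : ℕ) = m H₀ + 1) : A.IsFree m ↔ A.IsFree m' := by
  have hx0 : linearForm (A.form H₀) ≠ 0 := (A.prime_linearForm H₀).ne_zero
  -- It suffices to have splitting derivations for both multiplicities.
  suffices key : A.IsFree m ∨ A.IsFree m' →
      ∃ θ ∈ A.logDer m, θ (linearForm (A.form H₀)) = linearForm (A.form H₀) ^ (m H₀ : ℕ) by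
    have key' : A.IsFree m ∨ A.IsFree m' → (A.IsFree m ↔ A.IsFree m') := fun hor => by
      obtain ⟨θ, hθ, hθx⟩ := key hor
      have hθ' : linearForm (A.form H₀) • θ ∈ A.logDer m' := mem_logDer_iff.2 fun H => by
        rw [Derivation.smul_apply, smul_eq_mul]
        rcases eq_or_ne H H₀ with rfl | hH
        · rw [hθx, h₀, pow_succ']
        · rw [h H hH]
          exact Dvd.dvd.mul_left (mem_logDer_iff.1 hθ H) _
      rw [isFree_iff_free_prod_logDerKer hθ hθx, isFree_iff_free_prod_logDerKer hθ'
        (by rw [Derivation.smul_apply, smul_eq_mul, hθx, h₀, pow_succ']), logDerKer_congr h]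
    exact ⟨fun hm => (key' (Or.inl hm)).1 hm, fun hm => (key' (Or.inr hm)).2 hm⟩
  rintro (hm | hm)
  · obtain ⟨θ, hθ, hθx, -⟩ := hH₀.exists_logDer_eq_pow hm
    exact ⟨θ, hθ, hθx⟩
  · obtain ⟨θ, hθ, hθx, hθv⟩ := hH₀'.exists_logDer_eq_pow hm
    obtain ⟨η, rfl⟩ := Derivation.exists_eq_smul_of_dvd hx0 (dvd_derivation_apply hθv)
    have hηx : η (linearForm (A.form H₀)) = linearForm (A.form H₀) ^ (m H₀ : ℕ) := by
      rw [Derivation.smul_apply, smul_eq_mul, h₀, pow_succ'] at hθx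
      exact mul_left_cancel₀ hx0 hθx
    refine ⟨η, mem_logDer_iff.2 fun H => ?_, hηx⟩
    rcases eq_or_ne H H₀ with rfl | hH
    · rw [hηx]
    · rw [← h H hH]
      exact (A.prime_linearForm H).pow_dvd_of_dvd_mul_left _
        (fun hd => hH (linearForm_dvd_linearForm_iff.1 hd).symm) (mem_logDer_iff.1 hθ H)

theorem IsLocallyHeavy.of_le {m' : A.Multiplicity} (hH₀ : A.IsLocallyHeavy m H₀)
    (h : ∀ H ≠ H₀, m' H = m H) (h₀ : (m H₀ : ℕ) ≤ m' H₀) : A.IsLocallyHeavy m' H₀ := by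
  intro X hX hcard
  refine le_trans (le_of_eq (Finset.sum_congr rfl fun L hL => ?_)) ((hH₀ X hX hcard).trans h₀)
  rw [h L (Finset.mem_erase.1 hL).1]

theorem IsLocallyHeavy.isFree_iff_of_eq_add (n : ℕ) {m m' : A.Multiplicity}
    (hH₀ : A.IsLocallyHeavy m H₀) (h : ∀ H ≠ H₀, m' H = m H)
    (h₀ : (m' H₀ : ℕ) = m H₀ + n) : A.IsFree m ↔ A.IsFree m' := by
  induction n generalizing m with
  | zero =>
    have : m' = m := funext fun H => by
      rcases eq_or_ne H H₀ with rfl | hH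
      · exact PNat.coe_injective h₀
      · exact h H hH
    rw [this]
  | succ n ih =>
    have h1 : ∀ H ≠ H₀, Function.update m H₀ (m H₀ + 1) H = m H := fun H hH =>
      Function.update_of_ne hH _ _
    have h2 : (Function.update m H₀ (m H₀ + 1) H₀ : ℕ) = m H₀ + 1 := by simp
    have h3 := hH₀.of_le h1 (h2 ▸ Nat.le_succ _)
    refine (hH₀.isFree_iff_of_eq_add_one h3 h1 h2).trans (ih h3 (fun H hH => ?_) ?_)
    · rw [h H hH, h1 H hH]
    · rw [h₀, h2]
      ring

theorem IsLocallyHeavy.isFree_iff_of_isShift {m' : A.Multiplicity} {k : ℤ}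
    (hH₀ : A.IsLocallyHeavy m H₀) (hH₀' : A.IsLocallyHeavy m' H₀) (h : A.IsShift m H₀ k m') :
    A.IsFree m ↔ A.IsFree m' := by
  have h1 : ∀ H ≠ H₀, m' H = m H := fun H hH => by
    have := h H
    rw [delta, if_neg hH, mul_zero, add_zero] at this
    exact PNat.coe_injective (by exact_mod_cast this)
  have h2 := h H₀
  rw [delta, if_pos rfl, mul_one] at h2
  rcases le_total 0 k with hk | hk
  · exact hH₀.isFree_iff_of_eq_add k.toNat h1 (by omega)
  · exact (hH₀'.isFree_iff_of_eq_add (-k).toNat (fun H hH => (h1 H hH).symm) (by omega)).symm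

end

end Arrangement

theorem mainTheorem4 {K V : Type*} [Field K] [AddCommGroup V] [Module K V]
    [FiniteDimensional K V] (A : Arrangement K V) (m : A.Multiplicity) (H₀ : A.Hyp)
    (hH₀ : A.IsLocallyHeavy m H₀) :
    List.TFAE [
      A.IsFree m,
      ∃ (k : ℤ) (m' : A.Multiplicity),
        A.IsShift m H₀ k m' ∧ A.IsLocallyHeavy m' H₀ ∧ A.IsFree m',
      ∀ (k : ℤ) (m' : A.Multiplicity),
        A.IsShift m H₀ k m' → A.IsLocallyHeavy m' H₀ → A.IsFree m'] := by
  tfae_have 1 → 3 := fun h _ _ hs hh => (hH₀.isFree_iff_of_isShift hh hs).1 h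
  tfae_have 3 → 2 := fun h =>
    have hs : A.IsShift m H₀ 0 m := fun H => by simp
    ⟨0, m, hs, hH₀, h 0 m hs hH₀⟩
  tfae_have 2 → 1 := fun ⟨_, _, hs, hh, hf⟩ => (hH₀.isFree_iff_of_isShift hh hs).2 hf
  tfae_finish
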